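/- Let $K$ be a field of characteristic $0$ and consider $K[x_1,\ldots,x_n]$ with the variables ordered $x_1<\cdots<x_n$ and with the corresponding lexicographical term order. For a nonconstant polynomial $F$, the leading variable $\mathrm{lv}(F)$ is the greatest variable appearing in $F$, and the initial $\mathrm{ini}(F)$ is the leading coefficient of $F$ viewed as a polynomial in $\mathrm{lv}(F)$. A triangular set is a finite nonempty ordered set $T=[T_1,\ldots,T_r]$ of nonconstant polynomials with $\mathrm{lv}(T_1)<\cdots<\mathrm{lv}(T_r)$. With $J=\mathrm{ini}(T_1)\cdots\mathrm{ini}(T_r)$, its saturated ideal is $\mathrm{sat}(T)=\{P : PJ^k\in\langle T\rangle \text{ for some } k\ge 0\}$ (and $\mathrm{sat}(\emptyset)=\langle 0\rangle$). The trivial triangular sets $[c]$ with $c\in K\setminus\{0\}$ are also admitted, with $\mathrm{sat}([c])=\langle 1\rangle$. A triangular set $T=[T_1,\ldots,T_r]$ is called regular if, for every $i=1,\ldots,r$, $\mathrm{ini}(T_i)$ is neither zero nor a zero divisor in $K[x_1,\ldots,x_n]/\mathrm{sat}([T_1,\ldots,T_{i-1}])$; by convention, the trivial sets $[c]$ are regular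 too. The W-characteristic set of an ideal $I$ with reduced lexicographical Gröbner basis $G$ consists of the constants in $G$ together with, for each $i=1,\ldots,n$ such that $G$ contains polynomials with leading variable $x_i$, the one among these with the smallest leading term; it is ordered by increasing leading variable. A reduced lexicographical Gröbner basis $G$ is called characterizable if $\langle G\rangle=\mathrm{sat}(C)$, where $C$ is the W-characteristic set of $\langle G\rangle$. Proposition. If $G\neq\emptyset$ is a characterizable Gröbner basis, then the W-characteristic set $C$ of $\langle G\rangle$ is regular. -/

import Mathlib

open MvPolynomial

noncomputable section

namespace WChar

/-- The lexicographic term order on exponents in the variables `x_0 < x_1 < ⋯ < x_{n-1}`.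
Mathlib's `MonomialOrder.lex` makes the variable with the smallest index the greatest one, so the
index type is reversed; see `lexOrder_lt_iff`. -/
def lexOrder (n : ℕ) : MonomialOrder (Fin n) where
  syn := (MonomialOrder.lex (σ := (Fin n)ᵒᵈ)).syn
  toSyn := (Finsupp.domCongr OrderDual.toDual).trans
    (MonomialOrder.lex (σ := (Fin n)ᵒᵈ)).toSyn
  toSyn_monotone := fun a b h =>
    (MonomialOrder.lex (σ := (Fin n)ᵒᵈ)).toSyn_monotone (fun i => h (OrderDual.ofDual i))

/-- `c < d` if and only if `c_j < d_j` at the largest index `j` where `c` and `d` differ. -/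
theorem lexOrder_lt_iff {n : ℕ} (c d : Fin n →₀ ℕ) :
    (lexOrder n).toSyn c < (lexOrder n).toSyn d ↔
      ∃ j, (∀ i, j < i → c i = d i) ∧ c j < d j := by
  change toLex (Finsupp.domCongr OrderDual.toDual c) <
    toLex (Finsupp.domCongr OrderDual.toDual d) ↔ _
  rw [Finsupp.Lex.lt_iff]
  exact Iff.rfl

variable {n : ℕ} {K : Type*} [Field K]

/-- The leading variable: the index of the greatest variable that appears in `F`; it is `⊥`
exactly for constant polynomials. -/
def lv (F : MvPolynomial (Fin n) K) : WithBot (Fin n) :=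
  F.vars.max

/-- The coefficient of `x_i ^ k` in `F`, for `k = deg(F, x_i)`, where `F` is seen as a polynomial in
`x_i` whose coefficients are polynomials in the other variables. -/
def leadCoeffIn (i : Fin n) (F : MvPolynomial (Fin n) K) : MvPolynomial (Fin n) K :=
  ∑ d ∈ F.support with d i = F.degreeOf i, monomial (d.erase i) (F.coeff d)

/-- The initial of `F`: its leading coefficient with respect to its leading variable.
(Initials of constants play no role; the value is set to `F` itself.) -/
def ini (F : MvPolynomial (Fin n) K) : MvPolynomial (Fin n) K :=
  WithBot.recBotCoe F (fun i => leadCoeffIn i F) (lv F)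

/-- A (nontrivial) triangular set: a finite nonempty ordered set of nonconstant polynomials with
strictly increasing leading variables. -/
def IsTriangularSet (T : List (MvPolynomial (Fin n) K)) : Prop :=
  T ≠ [] ∧ (∀ P ∈ T, lv P ≠ ⊥) ∧ T.Pairwise (fun P Q => lv P < lv Q)

/-- A trivial triangular set: `[c]` for a nonzero constant `c`. -/
def IsTrivialTriangularSet (T : List (MvPolynomial (Fin n) K)) : Prop :=
  ∃ c : K, c ≠ 0 ∧ T = [C c]

/-- The saturated ideal `{P | ∃ k, P * J ^ k ∈ ⟨T⟩}`, where `J` is the product of the initials of the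
polynomials in `T`. It is the unit ideal when `T = [c]` with `c` a nonzero constant (see
`sat_trivial`), and the zero ideal for the empty list. -/
def sat (T : List (MvPolynomial (Fin n) K)) : Ideal (MvPolynomial (Fin n) K) where
  carrier := {P | ∃ k : ℕ, P * (T.map ini).prod ^ k ∈ Ideal.span {Q | Q ∈ T}}
  zero_mem' := ⟨0, by simp⟩
  add_mem' := by
    rintro P Q ⟨k, hk⟩ ⟨l, hl⟩
    refine ⟨k + l, ?_⟩
    have h := Ideal.add_mem _ (Ideal.mul_mem_right ((T.map ini).prod ^ l) _ hk)
      (Ideal.mul_mem_right ((T.map ini).prod ^ k) _ hl)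
    convert h using 1
    ring
  smul_mem' := by
    rintro R P ⟨k, hk⟩
    refine ⟨k, ?_⟩
    rw [smul_eq_mul, mul_assoc]
    exact Ideal.mul_mem_left _ R hk

theorem sat_trivial {T : List (MvPolynomial (Fin n) K)} (hT : IsTrivialTriangularSet T) :
    sat T = ⊤ := by
  obtain ⟨c, hc, rfl⟩ := hT
  refine (Ideal.eq_top_iff_one _).2 ⟨0, ?_⟩
  have h : (C c⁻¹ : MvPolynomial (Fin n) K) * C c ∈ Ideal.span {Q | Q ∈ [(C c)]} :=
    Ideal.mul_mem_left _ _ (Ideal.subset_span (by simp))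
  rwa [← C_mul, inv_mul_cancel₀ hc, C_1, ← one_mul (1 : MvPolynomial (Fin n) K),
    ← pow_zero ((List.map ini [(C c : MvPolynomial (Fin n) K)]).prod)] at h

/-- Regular sets (regular chains): triangular sets `[T_1, …, T_r]` such that, for each `i`, the
initial of `T_i` is neither zero nor a zero divisor modulo `sat [T_1, …, T_{i-1}]`.
By convention the trivial triangular sets `[c]` are regular as well. -/
def IsRegularSet (T : List (MvPolynomial (Fin n) K)) : Prop :=
  IsTrivialTriangularSet T ∨
    (IsTriangularSet T ∧ ∀ (i : ℕ) (hi : i < T.length),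
      Ideal.Quotient.mk (sat (T.take i)) (ini T[i]) ≠ 0 ∧
        Ideal.Quotient.mk (sat (T.take i)) (ini T[i]) ∈
          nonZeroDivisors (MvPolynomial (Fin n) K ⧸ sat (T.take i)))

/-- `G` is a lexicographical Gröbner basis of the ideal `I`. -/
def IsGroebnerBasis (I : Ideal (MvPolynomial (Fin n) K)) (G : Finset (MvPolynomial (Fin n) K)) :
    Prop :=
  (∀ P ∈ G, P ∈ I) ∧
    Ideal.span ((lexOrder n).leadingTerm '' {P | P ∈ G}) =
      Ideal.span ((lexOrder n).leadingTerm '' {P | P ∈ I})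

/-- `G` is a reduced lexicographical Gröbner basis of `I`: its elements are monic, and no term of
any of them is divisible by the leading term of another one. -/
def IsReducedGroebnerBasis (I : Ideal (MvPolynomial (Fin n) K))
    (G : Finset (MvPolynomial (Fin n) K)) : Prop :=
  IsGroebnerBasis I G ∧ (∀ P ∈ G, (lexOrder n).Monic P) ∧
    ∀ P ∈ G, ∀ Q ∈ G, Q ≠ P → ∀ d ∈ P.support, ¬ (lexOrder n).degree Q ≤ d

open Classical in
/-- The reduced lexicographical Gröbner basis of `I` (every ideal has exactly one). -/
def reducedGroebnerBasis (I : Ideal (MvPolynomial (Fin n) K)) :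
    Finset (MvPolynomial (Fin n) K) :=
  if h : ∃ G, IsReducedGroebnerBasis I G then h.choose else ∅

/-- A polynomial in the nonempty finite set `S` with the smallest leading term. (The leading terms
of the elements of a reduced Gröbner basis are distinct, so it is unique in the use below.) -/
def smallest (S : Finset (MvPolynomial (Fin n) K)) (hS : S.Nonempty) : MvPolynomial (Fin n) K :=
  (S.exists_min_image (fun P => (lexOrder n).toSyn ((lexOrder n).degree P)) hS).choose

open Classical in
/-- The W-characteristic set of `I`: the constants in the reduced lexicographical Gröbner basis of
`I`, followed, for each variable in increasing order, by the smallest element of the basis with this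
leading variable, if there is any. -/
def wCharSet (I : Ideal (MvPolynomial (Fin n) K)) : List (MvPolynomial (Fin n) K) :=
  {P ∈ reducedGroebnerBasis I | lv P = ⊥}.toList ++
    (List.finRange n).filterMap (fun i =>
      if h : {P ∈ reducedGroebnerBasis I | lv P = i}.Nonempty then some (smallest _ h) else none)

/-- `G` is a characterizable Gröbner basis: it is the reduced lexicographical Gröbner basis of
the ideal `⟨G⟩`, and `⟨G⟩` is the saturated ideal of the W-characteristic set of `⟨G⟩`. -/
def IsCharacterizable (G : Finset (MvPolynomial (Fin n) K)) : Prop :=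
  IsReducedGroebnerBasis (Ideal.span {P | P ∈ G}) G ∧
    Ideal.span {P | P ∈ G} = sat (wCharSet (Ideal.span {P | P ∈ G}))

end WChar

end

open MvPolynomial

noncomputable section

namespace WChar

/-! ### Initials and pseudo-division in one variable. -/

section Initials

variable {n : ℕ} {K : Type*} [Field K]

/-! Every nonzero `P` in the ideal is reducible by some `Q` in `C`: its degree in `x_v`, `v = lv Q`,
is at least that of `Q`. Indeed some `g` in the Gröbner basis has leading monomial dividing that of
`P`, and the element of `C` with the leading variable of `g` has no larger degree in it
(`exists_mem_wCharSet_degreeOf_le`).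

As the ideal is `sat C`, this reducibility forces regularity (`isRegularSet_of_forall_reducible`).
Let `U` be the elements of `C` before `T_i`, `h = ini T_i`, `m = lv T_i`, and `P * h ∈ sat U`. Since
`h` and `U` involve only variables below `m`, `P` may be replaced by its coefficients with respect
to the other variables. Such a `P` lies in `sat C`, so if nonzero it is reducible by some `Q`, which
must lie in `U`. Its pseudo-remainder satisfies the same hypotheses and is smaller, so by induction
it lies in `sat U`; cancelling `ini Q` puts `P` there. If `h` were zero modulo `sat U`, then `1`
would lie in `sat C`, but `1` is not reducible. A constant in the basis makes `C` trivial. -/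

theorem ini_eq_leadCoeffIn {F : MvPolynomial (Fin n) K} {v : Fin n} (hv : lv F = v) :
    ini F = leadCoeffIn v F := by
  unfold ini
  rw [hv]
  rfl

theorem mem_vars_of_lv_eq {F : MvPolynomial (Fin n) K} {v : Fin n} (hv : lv F = v) :
    v ∈ F.vars :=
  Finset.mem_of_max hv

theorem degreeOf_pos_of_lv_eq {F : MvPolynomial (Fin n) K} {v : Fin n} (hv : lv F = v) :
    0 < F.degreeOf v := by
  classical
  have h := mem_vars_of_lv_eq hv
  rw [vars_def, Multiset.mem_toFinset] at h
  rw [degreeOf_def]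
  exact Multiset.count_pos.2 h

theorem degreeOf_eq_zero_of_notMem_vars {F : MvPolynomial (Fin n) K} {j : Fin n}
    (h : j ∉ F.vars) : F.degreeOf j = 0 := by
  classical
  rw [vars_def, Multiset.mem_toFinset] at h
  rw [degreeOf_def]
  exact Multiset.count_eq_zero.2 h

theorem notMem_vars_of_degreeOf_eq_zero {F : MvPolynomial (Fin n) K} {j : Fin n}
    (h : F.degreeOf j = 0) : j ∉ F.vars := by
  classical
  rw [vars_def, Multiset.mem_toFinset]
  rw [degreeOf_def] at h
  exact Multiset.count_eq_zero.1 h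

theorem degreeOf_eq_zero_of_lv_lt {F : MvPolynomial (Fin n) K} {j : Fin n}
    (h : lv F < j) : F.degreeOf j = 0 :=
  degreeOf_eq_zero_of_notMem_vars fun hj => (Finset.le_max hj).not_gt h

/-- Membership in the subalgebra of polynomials in the variables below `m`. -/
theorem mem_supported_lt_iff {F : MvPolynomial (Fin n) K} {m : Fin n} :
    F ∈ supported K {j | j < m} ↔ ∀ j, m ≤ j → F.degreeOf j = 0 := by
  rw [mem_supported]
  refine ⟨fun h j hj => degreeOf_eq_zero_of_notMem_vars fun hm => (h hm).not_ge hj, ?_⟩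
  intro h j hj
  by_contra hlt
  exact notMem_vars_of_degreeOf_eq_zero (h j (not_lt.1 hlt)) hj

theorem exists_of_mem_support_leadCoeffIn {F : MvPolynomial (Fin n) K} {i : Fin n}
    {d : Fin n →₀ ℕ} (hd : d ∈ (leadCoeffIn i F).support) :
    ∃ c ∈ F.support, d = c.erase i := by
  classical
  obtain ⟨c, hc, hdc⟩ := Finset.mem_biUnion.1 (support_sum hd)
  exact ⟨c, (Finset.mem_filter.1 hc).1, Finset.mem_singleton.1 (support_monomial_subset hdc)⟩

theorem degreeOf_leadCoeffIn_self (i : Fin n) (F : MvPolynomial (Fin n) K) :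
    (leadCoeffIn i F).degreeOf i = 0 := by
  rw [← Nat.le_zero, degreeOf_le_iff]
  intro d hd
  obtain ⟨c, -, rfl⟩ := exists_of_mem_support_leadCoeffIn hd
  simp

theorem degreeOf_leadCoeffIn_le (i j : Fin n) (F : MvPolynomial (Fin n) K) :
    (leadCoeffIn i F).degreeOf j ≤ F.degreeOf j := by
  rw [degreeOf_le_iff]
  intro d hd
  obtain ⟨c, hc, rfl⟩ := exists_of_mem_support_leadCoeffIn hd
  refine le_trans ?_ (le_degreeOf_of_mem_support j hc)
  rw [Finsupp.erase_apply]
  split_ifs <;> simp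

/-- The part of `F` of lower degree in `x_i`. -/
def lowerPart (i : Fin n) (F : MvPolynomial (Fin n) K) : MvPolynomial (Fin n) K :=
  ∑ d ∈ F.support with ¬ d i = F.degreeOf i, monomial d (F.coeff d)

theorem X_pow_mul_leadCoeffIn_add_lowerPart (i : Fin n) (F : MvPolynomial (Fin n) K) :
    X i ^ F.degreeOf i * leadCoeffIn i F + lowerPart i F = F := by
  conv_rhs => rw [F.as_sum, ← Finset.sum_filter_add_sum_filter_not _ (fun d => d i = F.degreeOf i)]
  rw [leadCoeffIn, lowerPart, Finset.mul_sum]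
  congr 1
  refine Finset.sum_congr rfl fun d hd => ?_
  rw [← (Finset.mem_filter.1 hd).2, X_pow_eq_monomial, monomial_mul, one_mul,
    Finsupp.single_add_erase]

theorem exists_of_mem_support_lowerPart {F : MvPolynomial (Fin n) K} {i : Fin n}
    {d : Fin n →₀ ℕ} (hd : d ∈ (lowerPart i F).support) :
    d ∈ F.support ∧ d i ≠ F.degreeOf i := by
  classical
  obtain ⟨c, hc, hdc⟩ := Finset.mem_biUnion.1 (support_sum hd)
  obtain rfl := Finset.mem_singleton.1 (support_monomial_subset hdc)
  exact Finset.mem_filter.1 hc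

theorem degreeOf_lowerPart_le (i j : Fin n) (F : MvPolynomial (Fin n) K) :
    (lowerPart i F).degreeOf j ≤ F.degreeOf j :=
  degreeOf_le_iff.2 fun _ hd =>
    le_degreeOf_of_mem_support j (exists_of_mem_support_lowerPart hd).1

theorem degreeOf_lowerPart_lt {i : Fin n} {F : MvPolynomial (Fin n) K}
    (h : 0 < F.degreeOf i) : (lowerPart i F).degreeOf i < F.degreeOf i :=
  (degreeOf_lt_iff h).2 fun _ hd =>
    (le_degreeOf_of_mem_support i (exists_of_mem_support_lowerPart hd).1).lt_of_ne
      (exists_of_mem_support_lowerPart hd).2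

/-- One step of pseudo-division by `Q` with respect to its leading variable. -/
theorem exists_pseudo_reduction {P Q : MvPolynomial (Fin n) K} {v : Fin n} (hv : lv Q = v)
    (hle : Q.degreeOf v ≤ P.degreeOf v) :
    ∃ A R : MvPolynomial (Fin n) K, ini Q * P = A * Q + R ∧ R.degreeOf v < P.degreeOf v ∧
      ∀ j, v < j → R.degreeOf j ≤ P.degreeOf j := by
  have hpos := degreeOf_pos_of_lv_eq hv
  have hQj : ∀ j, v < j → Q.degreeOf j = 0 := fun j hj =>
    degreeOf_eq_zero_of_lv_lt (by rw [hv]; exact WithBot.coe_lt_coe.2 hj)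
  set e := P.degreeOf v with he
  set d := Q.degreeOf v with hd
  -- The quotient makes the terms of degree `e` in `x_v` cancel; the remainder collects the products
  -- that involve a lower part.
  refine ⟨X v ^ (e - d) * leadCoeffIn v P,
    leadCoeffIn v Q * lowerPart v P - X v ^ (e - d) * leadCoeffIn v P * lowerPart v Q, ?_, ?_, ?_⟩
  · have hP := X_pow_mul_leadCoeffIn_add_lowerPart v P
    have hQ := X_pow_mul_leadCoeffIn_add_lowerPart v Q
    rw [← he] at hP
    rw [← hd] at hQ
    rw [ini_eq_leadCoeffIn hv]
    conv_lhs => rw [← hP]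
    conv_rhs => rw [← hQ]
    have hpow : (X v : MvPolynomial (Fin n) K) ^ e = X v ^ (e - d) * X v ^ d := by
      rw [← pow_add, Nat.sub_add_cancel hle]
    -- Expanding `Q` also expanded it inside `leadCoeffIn` and `lowerPart`; these two equations undo
    -- that.
    have hlc' : leadCoeffIn v (X v ^ d * leadCoeffIn v Q + lowerPart v Q) = leadCoeffIn v Q := by
      rw [hQ]
    have hlp' : lowerPart v (X v ^ d * leadCoeffIn v Q + lowerPart v Q) = lowerPart v Q := by
      rw [hQ]
    simp only [hlc', hlp']
    rw [hpow]
    ring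
  · have h1 := degreeOf_mul_le v (leadCoeffIn v Q) (lowerPart v P)
    have h2 := degreeOf_mul_le v (X v ^ (e - d) * leadCoeffIn v P) (lowerPart v Q)
    have h3 := degreeOf_mul_le v (X v ^ (e - d)) (leadCoeffIn v P)
    rw [degreeOf_leadCoeffIn_self] at h1 h3
    rw [degreeOf_X_self_pow] at h3
    have h4 := degreeOf_lowerPart_lt hpos
    have h5 := degreeOf_lowerPart_lt (hpos.trans_le hle)
    refine (degreeOf_sub_le _ _ _).trans_lt (max_lt ?_ ?_) <;> omega
  · intro j hj
    have h1 := degreeOf_mul_le j (leadCoeffIn v Q) (lowerPart v P)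
    have h2 := degreeOf_mul_le j (X v ^ (e - d) * leadCoeffIn v P) (lowerPart v Q)
    have h3 := degreeOf_mul_le j (X v ^ (e - d)) (leadCoeffIn v P)
    rw [degreeOf_X_pow_of_ne _ hj.ne'] at h3
    have h4 := degreeOf_leadCoeffIn_le v j Q
    have h5 := degreeOf_lowerPart_le v j Q
    have h6 := degreeOf_leadCoeffIn_le v j P
    have h7 := degreeOf_lowerPart_le v j P
    have h8 := hQj j hj
    refine (degreeOf_sub_le _ _ _).trans (max_le ?_ ?_) <;> omega

end Initials

/-! ### Coefficients with respect to the variables that are at least `m`. -/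

section UpperCoefficients

variable {n : ℕ} {K : Type*} [Field K]

/-- The algebra homomorphism that regards a polynomial as a polynomial in the variables that are at
least `m`, with coefficients in the polynomials in the variables below `m`. -/
def splitUpper (m : Fin n) :
    MvPolynomial (Fin n) K →ₐ[K] MvPolynomial (Fin n) (MvPolynomial (Fin n) K) :=
  aeval fun j => if j < m then C (X j) else X j

theorem splitUpper_of_mem_supported {m : Fin n} {F : MvPolynomial (Fin n) K}
    (hF : F ∈ supported K {j | j < m}) : splitUpper m F = C F := by
  have h : Set.EqOn (splitUpper (K := K) m)
      (IsScalarTower.toAlgHom K (MvPolynomial (Fin n) K)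
        (MvPolynomial (Fin n) (MvPolynomial (Fin n) K))) (supported K {j | j < m}) := by
    rw [supported_eq_adjoin_X, AlgHom.eqOn_adjoin_iff]
    rintro _ ⟨j, hj, rfl⟩
    have hj' : j < m := hj
    simp [splitUpper, hj', algebraMap_eq]
  simpa [algebraMap_eq] using h hF

theorem aeval_X_splitUpper (m : Fin n) (F : MvPolynomial (Fin n) K) :
    aeval (R := MvPolynomial (Fin n) K) (X : Fin n → MvPolynomial (Fin n) K)
      (splitUpper m F) = F := by
  have h : ((aeval (R := MvPolynomial (Fin n) K)
      (X : Fin n → MvPolynomial (Fin n) K)).restrictScalars K).comp (splitUpper m)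
        = AlgHom.id K _ := by
    ext1 j
    by_cases hj : j < m <;> simp [splitUpper, hj]
  exact DFunLike.congr_fun h F

theorem coeff_splitUpper_mem_supported (m : Fin n) (F : MvPolynomial (Fin n) K)
    (d : Fin n →₀ ℕ) : (splitUpper m F).coeff d ∈ supported K {j | j < m} := by
  classical
  induction F using MvPolynomial.induction_on generalizing d with
  | C a =>
    have h : splitUpper m (C a) = (C (C a) : MvPolynomial (Fin n) (MvPolynomial (Fin n) K)) :=
      splitUpper_of_mem_supported ((supported K _).algebraMap_mem a)
    rw [h, coeff_C]
    split_ifs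
    · exact (supported K _).algebraMap_mem a
    · exact zero_mem _
  | add p q hp hq =>
    rw [map_add, coeff_add]
    exact add_mem (hp d) (hq d)
  | mul_X p i hp =>
    rw [map_mul, coeff_mul]
    refine sum_mem fun c _ => mul_mem (hp _) ?_
    by_cases hi : i < m
    · simp only [splitUpper, aeval_X, if_pos hi, coeff_C]
      split_ifs
      · exact X_mem_supported.2 hi
      · exact zero_mem _
    · simp only [splitUpper, aeval_X, if_neg hi, coeff_X]
      split_ifs
      · exact one_mem _
      · exact zero_mem _

/-- An ideal generated by polynomials in the variables below `m` contains, with each of its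
elements, its coefficients with respect to the other variables. -/
theorem coeff_splitUpper_mem_span {m : Fin n} {S : Set (MvPolynomial (Fin n) K)}
    (hS : S ⊆ supported K {j | j < m}) {F : MvPolynomial (Fin n) K} (hF : F ∈ Ideal.span S)
    (d : Fin n →₀ ℕ) : (splitUpper m F).coeff d ∈ Ideal.span S := by
  have h := Ideal.mem_map_of_mem (splitUpper m) hF
  -- The extension of an ideal to a polynomial ring consists of the polynomials with all
  -- coefficients in it, and `splitUpper m` sends the generators to constants.
  refine mem_map_C_iff.1 (?_ : splitUpper m F ∈ Ideal.map C (Ideal.span S)) d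
  rw [Ideal.map_span] at h
  refine Ideal.span_le.2 ?_ h
  rintro _ ⟨Q, hQ, rfl⟩
  rw [SetLike.mem_coe, splitUpper_of_mem_supported (hS hQ)]
  exact Ideal.mem_map_of_mem _ (Ideal.subset_span hQ)

theorem mem_of_forall_coeff_splitUpper_mem {m : Fin n} {I : Ideal (MvPolynomial (Fin n) K)}
    {F : MvPolynomial (Fin n) K} (h : ∀ d, (splitUpper m F).coeff d ∈ I) : F ∈ I := by
  rw [← aeval_X_splitUpper m F, aeval_def, eval₂_eq]
  exact sum_mem fun d _ => Ideal.mul_mem_right _ _ (h d)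

end UpperCoefficients

/-! ### Cancellation modulo saturated ideals, and the regularity criterion. -/

section Saturation

variable {n : ℕ} {K : Type*} [Field K]

theorem mem_sat_of_mem {T : List (MvPolynomial (Fin n) K)} {P : MvPolynomial (Fin n) K}
    (hP : P ∈ T) : P ∈ sat T :=
  ⟨0, by simpa using Ideal.subset_span (by exact hP)⟩

/-- `ini Q` divides the product of the initials, so one more power of that product absorbs it. -/
theorem mem_sat_of_ini_mul_mem {T : List (MvPolynomial (Fin n) K)} {P Q : MvPolynomial (Fin n) K}
    (hQ : Q ∈ T) (h : ini Q * P ∈ sat T) : P ∈ sat T := by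
  obtain ⟨k, hk⟩ := h
  obtain ⟨A, hA⟩ := List.dvd_prod (List.mem_map_of_mem (f := ini) hQ)
  refine ⟨k + 1, ?_⟩
  have : P * (T.map ini).prod ^ (k + 1) = A * (ini Q * P * (T.map ini).prod ^ k) := by
    rw [pow_succ]
    nth_rw 2 [hA]
    ring
  rw [this]
  exact Ideal.mul_mem_left _ _ hk

/-- Both `h` and the product of the initials are scalars for `splitUpper m`, so multiplying by them
commutes with taking coefficients. -/
theorem mul_coeff_splitUpper_mem_sat {U : List (MvPolynomial (Fin n) K)} {m : Fin n}
    (hU : ∀ Q ∈ U, Q ∈ supported K {j | j < m}) (hUini : ∀ Q ∈ U, ini Q ∈ supported K {j | j < m})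
    {h P : MvPolynomial (Fin n) K} (hh : h ∈ supported K {j | j < m}) (hP : P * h ∈ sat U)
    (d : Fin n →₀ ℕ) : (splitUpper m P).coeff d * h ∈ sat U := by
  obtain ⟨k, hk⟩ := hP
  have hJ : (U.map ini).prod ^ k ∈ supported K {j | j < m} := by
    refine pow_mem (list_prod_mem fun x hx => ?_) k
    obtain ⟨Q, hQ, rfl⟩ := List.mem_map.1 hx
    exact hUini Q hQ
  have := coeff_splitUpper_mem_span (m := m) hU hk d
  rw [mul_assoc, map_mul, splitUpper_of_mem_supported (mul_mem hh hJ), mul_comm, coeff_C_mul,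
    mul_comm, ← mul_assoc] at this
  exact ⟨k, this⟩

/-- The degrees of `F` in all the variables, compared lexicographically. -/
def multidegree (F : MvPolynomial (Fin n) K) : (lexOrder n).syn :=
  (lexOrder n).toSyn (Finsupp.equivFunOnFinite.symm fun j => F.degreeOf j)

/-- Makes pseudo-division terminate: a step may raise degrees in variables below `v`, which the
lexicographic comparison ignores. -/
theorem multidegree_lt {F H : MvPolynomial (Fin n) K} {v : Fin n}
    (hlt : F.degreeOf v < H.degreeOf v) (hle : ∀ j, v < j → F.degreeOf j ≤ H.degreeOf j) :
    multidegree F < multidegree H := by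
  classical
  rw [multidegree, multidegree, lexOrder_lt_iff]
  simp only [Finsupp.equivFunOnFinite_symm_apply_apply]
  obtain ⟨j, hj, hmax⟩ := (Finset.univ.filter fun j => F.degreeOf j < H.degreeOf j).exists_max_image
    id ⟨v, by simpa using hlt⟩
  refine ⟨j, fun i hi => ?_, by simpa using hj⟩
  have hvj : v ≤ j := hmax v (by simpa using hlt)
  by_contra hne
  exact (hmax i (by simpa using (hle i (hvj.trans_lt hi)).lt_of_ne hne)).not_gt hi

/-- Induction on `multidegree`: the pseudo-remainder `R` of `P` by `Q` inherits both `R * h ∈ sat U`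
and the bound on its variables. -/
theorem mem_sat_of_mul_mem_of_mem_supported {U : List (MvPolynomial (Fin n) K)} {m : Fin n}
    {h : MvPolynomial (Fin n) K}
    (hred : ∀ P, P * h ∈ sat U → P ≠ 0 → P ∈ supported K {j | j < m} →
      ∃ Q ∈ U, ∃ v : Fin n, lv Q = v ∧ Q.degreeOf v ≤ P.degreeOf v)
    {P : MvPolynomial (Fin n) K} (hP : P * h ∈ sat U) (hPm : P ∈ supported K {j | j < m}) :
    P ∈ sat U := by
  induction hd : multidegree P using WellFoundedLT.induction generalizing P with
  | ind d ih =>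
    subst hd
    by_cases h0 : P = 0
    · rw [h0]; exact zero_mem _
    obtain ⟨Q, hQ, v, hv, hle⟩ := hred P hP h0 hPm
    obtain ⟨A, R, hAR, hlt, hj⟩ := exists_pseudo_reduction hv hle
    rw [mem_supported_lt_iff] at hPm
    have hvm : v < m := by
      by_contra hvm
      have := hPm v (not_lt.1 hvm)
      omega
    refine mem_sat_of_ini_mul_mem hQ ?_
    rw [hAR]
    refine add_mem (Ideal.mul_mem_left _ _ (mem_sat_of_mem hQ))
      (ih _ (multidegree_lt hlt hj) ?_ ?_ rfl)
    · have : R * h = ini Q * (P * h) - A * h * Q := by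
        rw [← mul_assoc, hAR]; ring
      rw [this]
      exact sub_mem (Ideal.mul_mem_left _ _ hP) (Ideal.mul_mem_left _ _ (mem_sat_of_mem hQ))
    · rw [mem_supported_lt_iff]
      intro j hmj
      have := hj j (hvm.trans_le hmj)
      rw [hPm j hmj] at this
      omega

theorem mem_sat_of_mul_mem {U : List (MvPolynomial (Fin n) K)} {m : Fin n}
    (hU : ∀ Q ∈ U, Q ∈ supported K {j | j < m}) (hUini : ∀ Q ∈ U, ini Q ∈ supported K {j | j < m})
    {h : MvPolynomial (Fin n) K} (hh : h ∈ supported K {j | j < m})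
    (hred : ∀ P, P * h ∈ sat U → P ≠ 0 → P ∈ supported K {j | j < m} →
      ∃ Q ∈ U, ∃ v : Fin n, lv Q = v ∧ Q.degreeOf v ≤ P.degreeOf v)
    {P : MvPolynomial (Fin n) K} (hP : P * h ∈ sat U) : P ∈ sat U :=
  mem_of_forall_coeff_splitUpper_mem (m := m) fun d =>
    mem_sat_of_mul_mem_of_mem_supported hred (mul_coeff_splitUpper_mem_sat hU hUini hh hP d)
      (coeff_splitUpper_mem_supported m P d)

theorem mem_supported_of_lv_lt {F : MvPolynomial (Fin n) K} {m : Fin n} (h : lv F < m) :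
    F ∈ supported K {j | j < m} :=
  mem_supported_lt_iff.2 fun _ hj =>
    degreeOf_eq_zero_of_lv_lt (h.trans_le (WithBot.coe_le_coe.2 hj))

theorem ini_mem_supported_of_lv_eq {F : MvPolynomial (Fin n) K} {v : Fin n} (hv : lv F = v) :
    ini F ∈ supported K {j | j < v} := by
  rw [ini_eq_leadCoeffIn hv, mem_supported_lt_iff]
  intro j hj
  rcases hj.eq_or_lt with rfl | hj
  · exact degreeOf_leadCoeffIn_self _ _
  · have h1 := degreeOf_leadCoeffIn_le v j F
    have h2 : F.degreeOf j = 0 :=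
      degreeOf_eq_zero_of_lv_lt (by rw [hv]; exact WithBot.coe_lt_coe.2 hj)
    omega

/-- A triangular set is regular if every nonzero polynomial of its saturated ideal is reducible,
in the sense of pseudo-division, by some polynomial of the set. -/
theorem isRegularSet_of_forall_reducible {T : List (MvPolynomial (Fin n) K)}
    (hT : IsTriangularSet T)
    (hred : ∀ P ∈ sat T, P ≠ 0 → ∃ Q ∈ T, ∃ v : Fin n, lv Q = v ∧ Q.degreeOf v ≤ P.degreeOf v) :
    IsRegularSet T := by
  refine Or.inr ⟨hT, fun i hi => ?_⟩
  obtain ⟨-, hnc, hpair⟩ := hT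
  obtain ⟨m, hm⟩ := WithBot.ne_bot_iff_exists.1 (hnc T[i] (List.getElem_mem hi))
  set U := T.take i with hUdef
  have hUlt : ∀ Q ∈ U, lv Q < (m : WithBot (Fin n)) := by
    intro Q hQ
    obtain ⟨j, hj, rfl⟩ := List.mem_take_iff_getElem.1 hQ
    rw [hm]
    exact List.pairwise_iff_getElem.1 hpair j i _ hi (by omega)
  have hU : ∀ Q ∈ U, Q ∈ supported K {j | j < m} := fun Q hQ => mem_supported_of_lv_lt (hUlt Q hQ)
  have hUini : ∀ Q ∈ U, ini Q ∈ supported K {j | j < m} := by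
    intro Q hQ
    obtain ⟨v, hv⟩ := WithBot.ne_bot_iff_exists.1 (hnc Q (List.mem_of_mem_take hQ))
    have hvm : v < m := WithBot.coe_lt_coe.1 (by rw [hv]; exact hUlt Q hQ)
    exact supported_mono (fun j hj => lt_trans hj hvm) (ini_mem_supported_of_lv_eq hv.symm)
  -- `ini T[i]` is a factor of the product of initials of `T`, so saturating by `T` cancels it.
  have hsat : ∀ P, P * ini T[i] ∈ sat U → P ∈ sat T := by
    rintro P ⟨k, hk⟩
    have hspan : Ideal.span {Q | Q ∈ U} ≤ Ideal.span {Q | Q ∈ T} :=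
      Ideal.span_mono fun Q hQ => List.mem_of_mem_take hQ
    have hJ : (T.map ini).prod =
        (U.map ini).prod * (ini T[i] * ((T.drop (i + 1)).map ini).prod) := by
      conv_lhs => rw [← List.take_append_drop i T, List.drop_eq_getElem_cons hi]
      simp only [List.map_append, List.map_cons, List.prod_append, List.prod_cons, hUdef]
    refine ⟨k + 1, ?_⟩
    have : P * (T.map ini).prod ^ (k + 1) = (U.map ini).prod * (ini T[i]) ^ k *
        ((T.drop (i + 1)).map ini).prod ^ (k + 1) * (P * ini T[i] * (U.map ini).prod ^ k) := by
      rw [hJ]; ring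
    rw [this]
    exact Ideal.mul_mem_left _ _ (hspan hk)
  have hcancel : ∀ P, P * ini T[i] ∈ sat U → P ∈ sat U := by
    refine fun P hP => mem_sat_of_mul_mem hU hUini (ini_mem_supported_of_lv_eq hm.symm) ?_ hP
    intro F hF hF0 hFm
    obtain ⟨Q, hQ, v, hv, hle⟩ := hred F (hsat F hF) hF0
    refine ⟨Q, ?_, v, hv, hle⟩
    -- `Q` has positive degree in `x_v`, hence so has `F`, whose variables are below `m`. As leading
    -- variables increase along `T`, `Q` then comes before position `i`.
    have hvm : v < m := by
      by_contra hvm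
      have h1 := mem_supported_lt_iff.1 hFm v (not_lt.1 hvm)
      have h2 := degreeOf_pos_of_lv_eq hv
      omega
    obtain ⟨j, hj, rfl⟩ := List.getElem_of_mem hQ
    refine List.mem_take_iff_getElem.2 ⟨j, ?_, rfl⟩
    refine lt_min ?_ hj
    by_contra hij
    have : (m : WithBot (Fin n)) ≤ v := by
      rw [hm, ← hv]
      rcases (not_lt.1 hij).eq_or_lt with rfl | hlt
      · exact le_rfl
      · exact (List.pairwise_iff_getElem.1 hpair i j hi hj hlt).le
    exact (WithBot.coe_le_coe.1 this).not_gt hvm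
  constructor
  -- Otherwise `1 ∈ sat T`, but `1` has degree zero in every variable and is not reducible.
  · intro h0
    have h1 : (1 : MvPolynomial (Fin n) K) ∈ sat T :=
      hsat 1 (by rw [one_mul]; exact Ideal.Quotient.eq_zero_iff_mem.1 h0)
    obtain ⟨Q, -, v, hv, hle⟩ := hred 1 h1 one_ne_zero
    rw [degreeOf_one] at hle
    have := degreeOf_pos_of_lv_eq hv
    omega
  · rw [mem_nonZeroDivisors_iff_right]
    intro x hx
    obtain ⟨P, rfl⟩ := Ideal.Quotient.mk_surjective x
    rw [← map_mul, Ideal.Quotient.eq_zero_iff_mem] at hx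
    exact Ideal.Quotient.eq_zero_iff_mem.2 (hcancel P hx)

end Saturation

/-! ### Gröbner bases and the W-characteristic set. -/

section WCharacteristicSet

variable {n : ℕ} {K : Type*} [Field K]

theorem isReducedGroebnerBasis_reducedGroebnerBasis {I : Ideal (MvPolynomial (Fin n) K)}
    (h : ∃ G, IsReducedGroebnerBasis I G) : IsReducedGroebnerBasis I (reducedGroebnerBasis I) := by
  unfold reducedGroebnerBasis
  rw [dif_pos h]
  exact h.choose_spec

theorem IsReducedGroebnerBasis.exists_degree_le {I : Ideal (MvPolynomial (Fin n) K)}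
    {G : Finset (MvPolynomial (Fin n) K)} (hG : IsReducedGroebnerBasis I G)
    {P : MvPolynomial (Fin n) K} (hP : P ∈ I) (h0 : P ≠ 0) :
    ∃ Q ∈ G, (lexOrder n).degree Q ≤ (lexOrder n).degree P := by
  classical
  have hmem : (lexOrder n).leadingTerm P ∈
      Ideal.span ((lexOrder n).leadingTerm '' {P | P ∈ G}) := by
    rw [hG.1.2]
    exact Ideal.subset_span ⟨P, hP, rfl⟩
  have himg : (lexOrder n).leadingTerm '' {P | P ∈ G} =
      (fun s => monomial s (1 : K)) '' ((lexOrder n).degree '' {P | P ∈ G}) := by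
    rw [Set.image_image]
    refine Set.image_congr fun Q hQ => ?_
    rw [MonomialOrder.leadingTerm, (hG.2.1 Q hQ).leadingCoeff_eq_one]
  rw [himg, mem_ideal_span_monomial_image] at hmem
  obtain ⟨_, ⟨Q, hQ, rfl⟩, hle⟩ := hmem ((lexOrder n).degree P) (by
    rw [MonomialOrder.support_leadingTerm' h0]
    exact Finset.mem_singleton_self _)
  exact ⟨Q, hQ, hle⟩

theorem apply_le_of_lexOrder_le {c d : Fin n →₀ ℕ} {v : Fin n}
    (h : (lexOrder n).toSyn c ≤ (lexOrder n).toSyn d)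
    (hcd : ∀ j, v < j → c j = d j) : c v ≤ d v := by
  by_contra! hlt
  exact h.not_gt ((lexOrder_lt_iff d c).2 ⟨v, fun j hj => (hcd j hj).symm, hlt⟩)

theorem apply_eq_zero_of_lv_lt {F : MvPolynomial (Fin n) K} {d : Fin n →₀ ℕ}
    (hd : d ∈ F.support) {j : Fin n} (hj : lv F < j) : d j = 0 := by
  have h1 := le_degreeOf_of_mem_support j hd
  have h2 := degreeOf_eq_zero_of_lv_lt hj
  omega

/-- No variable above `v` occurs in `F`, so the lexicographic order compares exponents of `x_v`
first. -/
theorem degreeOf_lv_eq {F : MvPolynomial (Fin n) K} {v : Fin n} (hv : lv F = v) (h0 : F ≠ 0) :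
    F.degreeOf v = (lexOrder n).degree F v := by
  have hlt : ∀ j, v < j → lv F < j := fun j hj => by rw [hv]; exact WithBot.coe_lt_coe.2 hj
  have hdeg := (lexOrder n).degree_mem_support h0
  refine le_antisymm (degreeOf_le_iff.2 fun d hd => ?_) (le_degreeOf_of_mem_support v hdeg)
  refine apply_le_of_lexOrder_le ((lexOrder n).le_degree hd) fun j hj => ?_
  rw [apply_eq_zero_of_lv_lt hd (hlt j hj), apply_eq_zero_of_lv_lt hdeg (hlt j hj)]

theorem smallest_mem (S : Finset (MvPolynomial (Fin n) K)) (hS : S.Nonempty) : smallest S hS ∈ S :=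
  (S.exists_min_image (fun P => (lexOrder n).toSyn ((lexOrder n).degree P)) hS).choose_spec.1

theorem smallest_le {S : Finset (MvPolynomial (Fin n) K)} (hS : S.Nonempty)
    {P : MvPolynomial (Fin n) K} (hP : P ∈ S) :
    (lexOrder n).toSyn ((lexOrder n).degree (smallest S hS)) ≤
      (lexOrder n).toSyn ((lexOrder n).degree P) :=
  (S.exists_min_image (fun P => (lexOrder n).toSyn ((lexOrder n).degree P)) hS).choose_spec.2 P hP

theorem eq_C_of_lv_eq_bot {F : MvPolynomial (Fin n) K} (h : lv F = ⊥) : ∃ c, F = C c := by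
  rw [lv, Finset.max_eq_bot] at h
  have hF : F ∈ supported K (∅ : Set (Fin n)) := by rw [mem_supported, h]; simp
  rw [supported_empty] at hF
  obtain ⟨c, hc⟩ := Algebra.mem_bot.1 hF
  exact ⟨c, hc.symm⟩

theorem IsReducedGroebnerBasis.ne_zero {I : Ideal (MvPolynomial (Fin n) K)}
    {G : Finset (MvPolynomial (Fin n) K)} (hG : IsReducedGroebnerBasis I G)
    {P : MvPolynomial (Fin n) K} (hP : P ∈ G) : P ≠ 0 :=
  (hG.2.1 P hP).ne_zero

/-- A reduced Gröbner basis that contains a constant has no other elements. -/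
theorem IsReducedGroebnerBasis.eq_of_lv_eq_bot {I : Ideal (MvPolynomial (Fin n) K)}
    {G : Finset (MvPolynomial (Fin n) K)} (hG : IsReducedGroebnerBasis I G)
    {P Q : MvPolynomial (Fin n) K} (hP : P ∈ G) (hQ : Q ∈ G) (hbot : lv Q = ⊥) : P = Q := by
  by_contra hne
  obtain ⟨c, rfl⟩ := eq_C_of_lv_eq_bot hbot
  refine hG.2.2 P hP _ hQ (Ne.symm hne) _ ((lexOrder n).degree_mem_support (hG.ne_zero hP)) ?_
  rw [MonomialOrder.degree_C]
  exact zero_le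

theorem wCharSet_eq_singleton {I : Ideal (MvPolynomial (Fin n) K)}
    (hG : IsReducedGroebnerBasis I (reducedGroebnerBasis I)) {Q : MvPolynomial (Fin n) K}
    (hQ : Q ∈ reducedGroebnerBasis I) (hbot : lv Q = ⊥) : wCharSet I = [Q] := by
  classical
  have h1 : ({P ∈ reducedGroebnerBasis I | lv P = ⊥} : Finset _) = {Q} := by
    ext P
    rw [Finset.mem_filter, Finset.mem_singleton]
    refine ⟨fun h => hG.eq_of_lv_eq_bot h.1 hQ hbot, ?_⟩
    rintro rfl
    exact ⟨hQ, hbot⟩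
  have h2 : ∀ i : Fin n, ¬ ({P ∈ reducedGroebnerBasis I | lv P = i} : Finset _).Nonempty := by
    rintro i ⟨P, hP⟩
    obtain ⟨hP, hPi⟩ := Finset.mem_filter.1 hP
    rw [hG.eq_of_lv_eq_bot hP hQ hbot, hbot] at hPi
    exact WithBot.bot_ne_coe hPi
  unfold wCharSet
  convert List.append_nil [Q] using 2
  · convert Finset.toList_singleton Q
  · rw [List.filterMap_eq_nil_iff]
    intro i hi
    obtain ⟨j, -, hj⟩ := List.mem_flatMap.1 hi
    obtain rfl := List.mem_singleton.1 hj
    exact dif_neg (by convert h2 j)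

-- The index in `wCharSet` has type `WithBot (Fin n)`, so its list is a monadic lift of
-- `List.finRange n`, built from `flatMap` and `pure`; a plain `map` is easier to use.
open Classical in
theorem wCharSet_eq_filterMap {I : Ideal (MvPolynomial (Fin n) K)}
    (hnc : ∀ P ∈ reducedGroebnerBasis I, lv P ≠ ⊥) :
    wCharSet I = ((List.finRange n).map ((↑) : Fin n → WithBot (Fin n))).filterMap (fun i =>
      if h : {P ∈ reducedGroebnerBasis I | lv P = i}.Nonempty then some (smallest _ h)
      else none) := by
  have h1 : {P ∈ reducedGroebnerBasis I | lv P = ⊥} = ∅ :=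
    Finset.filter_eq_empty_iff.2 fun P hP => hnc P hP
  unfold wCharSet
  rw [h1, Finset.toList_empty, List.nil_append]
  congr 1
  exact List.flatMap_pure_eq_map _ _

theorem mem_of_mem_wCharSet {I : Ideal (MvPolynomial (Fin n) K)}
    (hnc : ∀ P ∈ reducedGroebnerBasis I, lv P ≠ ⊥) {P : MvPolynomial (Fin n) K}
    (hP : P ∈ wCharSet I) : P ∈ reducedGroebnerBasis I := by
  classical
  rw [wCharSet_eq_filterMap hnc] at hP
  obtain ⟨i, -, hi⟩ := List.mem_filterMap.1 hP
  split_ifs at hi with h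
  rw [← Option.some.inj hi]
  exact (Finset.mem_filter.1 (smallest_mem _ h)).1

theorem pairwise_lv_lt_wCharSet {I : Ideal (MvPolynomial (Fin n) K)}
    (hnc : ∀ P ∈ reducedGroebnerBasis I, lv P ≠ ⊥) :
    (wCharSet I).Pairwise (fun P Q => lv P < lv Q) := by
  classical
  rw [wCharSet_eq_filterMap hnc, List.pairwise_filterMap, List.pairwise_map]
  refine (List.pairwise_lt_finRange n).imp ?_
  intro i j hij P hP Q hQ
  split_ifs at hP with hi
  split_ifs at hQ with hj
  rw [← Option.some.inj hP, ← Option.some.inj hQ, (Finset.mem_filter.1 (smallest_mem _ hi)).2,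
    (Finset.mem_filter.1 (smallest_mem _ hj)).2]
  exact WithBot.coe_lt_coe.2 hij

/-- Every element of the reduced Gröbner basis is dominated by the element of the W-characteristic
set with the same leading variable. -/
theorem exists_mem_wCharSet_le {I : Ideal (MvPolynomial (Fin n) K)}
    (hnc : ∀ P ∈ reducedGroebnerBasis I, lv P ≠ ⊥) {P : MvPolynomial (Fin n) K}
    (hP : P ∈ reducedGroebnerBasis I) {v : Fin n} (hv : lv P = v) :
    ∃ Q ∈ wCharSet I, lv Q = v ∧
      (lexOrder n).toSyn ((lexOrder n).degree Q) ≤ (lexOrder n).toSyn ((lexOrder n).degree P) := by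
  classical
  have hmem : P ∈ {P ∈ reducedGroebnerBasis I | lv P = v} := Finset.mem_filter.2 ⟨hP, hv⟩
  refine ⟨smallest _ ⟨P, hmem⟩, ?_, (Finset.mem_filter.1 (smallest_mem _ ⟨P, hmem⟩)).2,
    smallest_le _ hmem⟩
  rw [wCharSet_eq_filterMap hnc]
  exact List.mem_filterMap.2 ⟨v, List.mem_map_of_mem (List.mem_finRange v), dif_pos ⟨P, hmem⟩⟩

theorem exists_mem_wCharSet_degreeOf_le {I : Ideal (MvPolynomial (Fin n) K)}
    (hG : IsReducedGroebnerBasis I (reducedGroebnerBasis I))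
    (hnc : ∀ P ∈ reducedGroebnerBasis I, lv P ≠ ⊥) {P : MvPolynomial (Fin n) K} (hP : P ∈ I)
    (h0 : P ≠ 0) : ∃ Q ∈ wCharSet I, ∃ v : Fin n, lv Q = v ∧ Q.degreeOf v ≤ P.degreeOf v := by
  obtain ⟨g, hg, hle⟩ := hG.exists_degree_le hP h0
  obtain ⟨v, hv⟩ := WithBot.ne_bot_iff_exists.1 (hnc g hg)
  obtain ⟨Q, hQ, hQv, hQg⟩ := exists_mem_wCharSet_le hnc hg hv.symm
  have hQ0 := hG.ne_zero (mem_of_mem_wCharSet hnc hQ)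
  have hzero : ∀ F : MvPolynomial (Fin n) K, lv F = v → F ≠ 0 → ∀ j, v < j →
      (lexOrder n).degree F j = 0 := fun F hF hF0 j hj =>
    apply_eq_zero_of_lv_lt ((lexOrder n).degree_mem_support hF0)
      (by rw [hF]; exact WithBot.coe_lt_coe.2 hj)
  refine ⟨Q, hQ, v, hQv, ?_⟩
  calc Q.degreeOf v = (lexOrder n).degree Q v := degreeOf_lv_eq hQv hQ0
    _ ≤ (lexOrder n).degree g v := apply_le_of_lexOrder_le hQg fun j hj => by
        rw [hzero Q hQv hQ0 j hj, hzero g hv.symm (hG.ne_zero hg) j hj]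
    _ ≤ (lexOrder n).degree P v := hle v
    _ ≤ P.degreeOf v := le_degreeOf_of_mem_support v ((lexOrder n).degree_mem_support h0)

/-- Uniqueness of the reduced Gröbner basis is not needed: the argument works with whichever one
`reducedGroebnerBasis` picks. -/
theorem isRegularSet_wCharSet {I : Ideal (MvPolynomial (Fin n) K)}
    (hG : ∃ G, IsReducedGroebnerBasis I G) (hI : I ≠ ⊥) (hsat : I = sat (wCharSet I)) :
    IsRegularSet (wCharSet I) := by
  have hG := isReducedGroebnerBasis_reducedGroebnerBasis hG
  by_cases hnc : ∀ P ∈ reducedGroebnerBasis I, lv P ≠ ⊥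
  -- A nonzero element is reducible by some `Q`, which shows that the characteristic set is
  -- nonempty.
  · obtain ⟨P, hP, hP0⟩ := Submodule.exists_mem_ne_zero_of_ne_bot hI
    obtain ⟨Q, hQ, -⟩ := exists_mem_wCharSet_degreeOf_le hG hnc hP hP0
    refine isRegularSet_of_forall_reducible ⟨List.ne_nil_of_mem hQ,
      fun F hF => hnc F (mem_of_mem_wCharSet hnc hF), pairwise_lv_lt_wCharSet hnc⟩ ?_
    rw [← hsat]
    exact fun F hF hF0 => exists_mem_wCharSet_degreeOf_le hG hnc hF hF0
  · push Not at hnc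
    obtain ⟨Q, hQ, hbot⟩ := hnc
    obtain ⟨c, hc⟩ := eq_C_of_lv_eq_bot hbot
    refine Or.inl ⟨c, ?_, by rw [wCharSet_eq_singleton hG hQ hbot, hc]⟩
    rintro rfl
    exact hG.ne_zero hQ (by rw [hc, C_0])

end WCharacteristicSet

end WChar

end

theorem proposition3p2 {K : Type*} [Field K] [CharZero K] {n : ℕ}
    (G : Finset (MvPolynomial (Fin n) K)) (hne : G.Nonempty) (hG : WChar.IsCharacterizable G) :
    WChar.IsRegularSet (WChar.wCharSet (Ideal.span {P | P ∈ G})) := by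
  obtain ⟨P, hP⟩ := hne
  refine WChar.isRegularSet_wCharSet ⟨G, hG.1⟩ ?_ hG.2
  exact Submodule.ne_bot_iff _ |>.2 ⟨P, Ideal.subset_span hP, hG.1.ne_zero hP⟩
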